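/- Conventions. A CR manifold of type $(n,k)$ is a connected paracompact Hausdorff smooth manifold $M$ of dimension $2n+k$ together with a smooth rank $2n$ subbundle $HM\subset TM$ and a smooth complex structure $J$ on the fibres of $HM$ such that the smooth sections of $T^{0,1}M=\{X+iJX : X\in HM\}$ are closed under the Lie bracket. For $U\subset M$ open, $\mathcal{CR}(U)$ is the algebra of smooth functions $u:U\to\mathbb C$ whose differential annihilates $T^{0,1}M$ on $U$, and $\mathcal{CR}_{M,a}$ is the ring of germs at $a\in M$ of such functions. Let $X$ be a (paracompact Hausdorff) complex manifold with complex structure $J_X$, $\mathcal O(\Omega)$ the algebra of holomorphic functions on an open set $\Omega\subset X$, and $\mathcal O_{X,a}$ the ring of germs at $a$ of holomorphic functions. $M$ is a generic CR submanifold of $X$ if it is embedded in $X$ by a smooth embedding $\phi:M\to X$ (by which $M$ is identified with $\phi(M)$) such that $\phi_*(Jv)=J_X\phi_*(v)$ for $v\in HM$, $\phi_*(H_aM)=\phi_*(T_aM)\cap J_X(\phi_*(T_aM))$ for every $a\in M$, and $\dim_{\mathbb C}X=n+k$. The pair $(M,X)$ is an $E$-pair if $M$ is a generic CR submanifold of $X$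 and, for each $a\in M$, the restriction map $\mathcal O_{X,a}\to\mathcal{CR}_{M,a}$ is an isomorphism. Theorem 1.1. Let $(M,X)$ be an $E$-pair. Then for every open set $\omega\subset M$ there is an open set $\Omega\subset X$ such that (i) $\Omega\cap M=\omega$, and (ii) the restriction map $r:\mathcal O(\Omega)\to\mathcal{CR}(\omega)$ is an isomorphism. -/

import Mathlib

open Set Filter Topology Manifold
open scoped ContDiff

noncomputable section

/-- The model space `ℂ^N` of complex manifolds of dimension `N`. -/
abbrev CModel (N : ℕ) : Type := EuclideanSpace ℂ (Fin N)

/-- The model space `ℝ^d` of real manifolds of dimension `d`. -/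
abbrev RModel (d : ℕ) : Type := EuclideanSpace ℝ (Fin d)

section Real

variable {d : ℕ} {M : Type*} [TopologicalSpace M] [ChartedSpace (RModel d) M]

/-- `V` is a smooth (real) vector field on the set `U`. -/
def SmoothVectorFieldOn [IsManifold (𝓡 d) ∞ M] (V : ∀ x : M, TangentSpace (𝓡 d) x)
    (U : Set M) : Prop :=
  ContMDiffOn (𝓡 d) (𝓡 d).tangent ∞ (fun x => (⟨x, V x⟩ : TangentBundle (𝓡 d) M)) U

/-- The differential at `x` of a complex valued function, an `ℝ`-linear map `T_x M → ℂ`. -/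
def complexDifferential (u : M → ℂ) (x : M) : TangentSpace (𝓡 d) x →L[ℝ] ℂ :=
  mfderiv (𝓡 d) 𝓘(ℝ, ℂ) u x

end Real

section CR

/-- An almost CR structure of type `(n, k)` on a smooth manifold `M` of dimension `2n + k`: a smooth
rank `2n` subbundle `H` of the tangent bundle with a smooth complex structure `J` on its fibres. -/
structure AlmostCRStructure (n k : ℕ) (M : Type*) [TopologicalSpace M]
    [ChartedSpace (RModel (2 * n + k)) M] [IsManifold (𝓡 (2 * n + k)) ∞ M] where
  /-- the holomorphic tangent space -/
  H : ∀ x : M, Submodule ℝ (TangentSpace (𝓡 (2 * n + k)) x)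
  /-- the partial complex structure -/
  J : ∀ x : M, H x →ₗ[ℝ] H x
  /-- `H` has a smooth frame of `2n` vector fields near each point -/
  smooth_H : ∀ x₀ : M, ∃ U : Set M, IsOpen U ∧ x₀ ∈ U ∧
    ∃ s : Fin (2 * n) → ∀ x : M, TangentSpace (𝓡 (2 * n + k)) x,
      (∀ i, SmoothVectorFieldOn (s i) U) ∧
      ∀ x ∈ U, LinearIndependent ℝ (fun i => s i x) ∧
        Submodule.span ℝ (Set.range fun i => s i x) = H x
  J_J : ∀ (x : M) (v : H x), J x (J x v) = -v
  /-- `J` maps smooth local sections of `H` to smooth local sections of `H` -/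
  smooth_J : ∀ (U : Set M), IsOpen U → ∀ V : ∀ x : M, H x,
    SmoothVectorFieldOn (fun x => (V x : TangentSpace (𝓡 (2 * n + k)) x)) U →
    SmoothVectorFieldOn (fun x => (J x (V x) : TangentSpace (𝓡 (2 * n + k)) x)) U

variable {n k : ℕ} {M : Type*} [TopologicalSpace M]
  [ChartedSpace (RModel (2 * n + k)) M] [IsManifold (𝓡 (2 * n + k)) ∞ M]

/-- The complexified tangent vector `A + i B` at `x` lies in `T^{0,1} M = {X + i J X | X ∈ H M}`. -/
def AlmostCRStructure.MemT01 (S : AlmostCRStructure n k M) (x : M)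
    (A B : TangentSpace (𝓡 (2 * n + k)) x) : Prop :=
  ∃ hA : A ∈ S.H x, B = (S.J x ⟨A, hA⟩ : TangentSpace (𝓡 (2 * n + k)) x)

variable (n k M) in
/-- A CR structure: an almost CR structure that is formally integrable, i.e. the Lie bracket of two
smooth sections `V₁ + i V₂` and `W₁ + i W₂` of `T^{0,1} M`, which is
`([V₁, W₁] - [V₂, W₂]) + i ([V₁, W₂] + [V₂, W₁])`, is again a section of `T^{0,1} M`. -/
structure CRStructure extends AlmostCRStructure n k M where
  integrable : ∀ V₁ V₂ W₁ W₂ : ∀ x : M, TangentSpace (𝓡 (2 * n + k)) x,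
    SmoothVectorFieldOn V₁ univ → SmoothVectorFieldOn V₂ univ →
    SmoothVectorFieldOn W₁ univ → SmoothVectorFieldOn W₂ univ →
    (∀ x, toAlmostCRStructure.MemT01 x (V₁ x) (V₂ x)) →
    (∀ x, toAlmostCRStructure.MemT01 x (W₁ x) (W₂ x)) →
    ∀ x, toAlmostCRStructure.MemT01 x
      (VectorField.mlieBracket (𝓡 (2 * n + k)) V₁ W₁ x
        - VectorField.mlieBracket (𝓡 (2 * n + k)) V₂ W₂ x)
      (VectorField.mlieBracket (𝓡 (2 * n + k)) V₁ W₂ x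
        + VectorField.mlieBracket (𝓡 (2 * n + k)) V₂ W₁ x)

/-- `u` is a smooth CR function on the open set `U`: it is smooth on `U` and there `du` annihilates
`T^{0,1} M`. -/
structure IsCROn (S : CRStructure n k M) (u : M → ℂ) (U : Set M) : Prop where
  smooth : ContMDiffOn (𝓡 (2 * n + k)) 𝓘(ℝ, ℂ) ∞ u U
  dbar : ∀ x ∈ U, ∀ A B : TangentSpace (𝓡 (2 * n + k)) x, S.MemT01 x A B →
    complexDifferential u x A + Complex.I * complexDifferential u x B = 0

end CR

section Complex

variable {N : ℕ} {X : Type*} [TopologicalSpace X] [ChartedSpace (CModel N) X]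

variable (N) in
/-- `f` is holomorphic (that is, complex analytic) on the open set `U` of a complex manifold. -/
def IsHolomorphicOn (f : X → ℂ) (U : Set X) : Prop :=
  ContMDiffOn 𝓘(ℂ, CModel N) 𝓘(ℂ, ℂ) ω f U

variable (N) in
/-- The complex structure `J_X` on the real tangent spaces of a complex manifold `X`. In Mathlib the
tangent space at `p` is the model space `ℂ^N`, by means of the preferred chart at `p`; as that chart
is holomorphic, `J_X` is multiplication by `i`. -/
def complexJ (p : X) :
    TangentSpace 𝓘(ℝ, CModel N) p →L[ℝ] TangentSpace 𝓘(ℝ, CModel N) p :=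
  (Complex.I • ContinuousLinearMap.id ℝ (CModel N) : CModel N →L[ℝ] CModel N)

end Complex

section Maps

variable {n k N : ℕ} {M X : Type*} [TopologicalSpace M]
  [ChartedSpace (RModel (2 * n + k)) M] [IsManifold (𝓡 (2 * n + k)) ∞ M]
  [TopologicalSpace X] [ChartedSpace (CModel N) X]

variable (N) in
/-- A smooth map from a CR manifold to a complex manifold is CR if its differential intertwines
the (partial) complex structures. -/
structure IsCRMap (S : CRStructure n k M) (φ : M → X) : Prop where
  smooth : ContMDiff (𝓡 (2 * n + k)) 𝓘(ℝ, CModel N) ∞ φ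
  map_J : ∀ (a : M) (v : S.H a),
    mfderiv (𝓡 (2 * n + k)) 𝓘(ℝ, CModel N) φ a (S.J a v)
      = complexJ N (φ a) (mfderiv (𝓡 (2 * n + k)) 𝓘(ℝ, CModel N) φ a v)

variable (N) in
/-- A CR embedding into a complex manifold: a CR map that is a smooth embedding with
`φ_* (H_a M) = φ_* (T_a M) ∩ J_X (φ_* (T_a M))` for every `a`. -/
structure IsCREmbedding (S : CRStructure n k M) (φ : M → X) : Prop extends IsCRMap N S φ where
  embedding : IsSmoothEmbedding (𝓡 (2 * n + k)) 𝓘(ℝ, CModel N) ∞ φ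
  map_H : ∀ a : M,
    (S.H a).map (mfderiv (𝓡 (2 * n + k)) 𝓘(ℝ, CModel N) φ a).toLinearMap =
      (mfderiv (𝓡 (2 * n + k)) 𝓘(ℝ, CModel N) φ a).toLinearMap.range ⊓
        (mfderiv (𝓡 (2 * n + k)) 𝓘(ℝ, CModel N) φ a).toLinearMap.range.map
          (complexJ N (φ a)).toLinearMap

variable (N) in
/-- A CR embedding is generic if `dim_ℂ X = n + k`, where `(n, k)` is the type of `M`. -/
structure IsGenericCREmbedding (S : CRStructure n k M) (φ : M → X) : Prop
    extends IsCREmbedding N S φ where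
  generic : N = n + k

end Maps

section Rings

variable {N : ℕ} {X : Type*} [TopologicalSpace X] [ChartedSpace (CModel N) X]

theorem IsHolomorphicOn.mono {f : X → ℂ} {U V : Set X} (hf : IsHolomorphicOn N f U) (h : V ⊆ U) :
    IsHolomorphicOn N f V := ContMDiffOn.mono hf h

theorem IsHolomorphicOn.add {f g : X → ℂ} {U : Set X} (hf : IsHolomorphicOn N f U)
    (hg : IsHolomorphicOn N g U) : IsHolomorphicOn N (f + g) U := ContMDiffOn.add hf hg

theorem IsHolomorphicOn.mul {f g : X → ℂ} {U : Set X} (hf : IsHolomorphicOn N f U)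
    (hg : IsHolomorphicOn N g U) : IsHolomorphicOn N (f * g) U := ContMDiffOn.mul hf hg

theorem isHolomorphicOn_const (c : ℂ) (U : Set X) : IsHolomorphicOn N (fun _ : X => c) U :=
  contMDiffOn_const

theorem IsHolomorphicOn.contMDiffAt_real {f : X → ℂ} {U : Set X} (hf : IsHolomorphicOn N f U)
    (hU : IsOpen U) {x : X} (hx : x ∈ U) :
    ContMDiffAt 𝓘(ℝ, CModel N) 𝓘(ℝ, ℂ) ∞ f x := by
  have h : ContMDiffAt 𝓘(ℂ, CModel N) 𝓘(ℂ, ℂ) ω f x :=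
    ContMDiffOn.contMDiffAt hf (hU.mem_nhds hx)
  have h' : ContMDiffAt 𝓘(ℝ, CModel N) 𝓘(ℝ, ℂ) ω f x := ⟨h.1, h.2.restrict_scalars ℝ⟩
  exact h'.of_le le_top

theorem IsHolomorphicOn.mfderiv_complexJ {f : X → ℂ} {U : Set X} (hf : IsHolomorphicOn N f U)
    (hU : IsOpen U) {x : X} (hx : x ∈ U) (v : TangentSpace 𝓘(ℝ, CModel N) x) :
    (show ℂ from mfderiv 𝓘(ℝ, CModel N) 𝓘(ℝ, ℂ) f x (complexJ N x v))
      = Complex.I * (show ℂ from mfderiv 𝓘(ℝ, CModel N) 𝓘(ℝ, ℂ) f x v) := by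
  have h : ContMDiffAt 𝓘(ℂ, CModel N) 𝓘(ℂ, ℂ) ω f x :=
    ContMDiffOn.contMDiffAt hf (hU.mem_nhds hx)
  have h1 := (h.mdifferentiableAt (by simp)).hasMFDerivAt
  let D : CModel N →L[ℂ] ℂ := mfderiv 𝓘(ℂ, CModel N) 𝓘(ℂ, ℂ) f x
  have h2 : HasMFDerivAt 𝓘(ℝ, CModel N) 𝓘(ℝ, ℂ) f x (D.restrictScalars ℝ) :=
    ⟨h1.1, HasFDerivWithinAt.restrictScalars ℝ h1.2⟩
  rw [h2.mfderiv]
  exact D.map_smul Complex.I v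

variable (N) in
/-- `𝒪(U)`: the algebra of holomorphic functions on the open set `U`. -/
def holFunctions (U : TopologicalSpace.Opens X) : Subalgebra ℂ (U → ℂ) where
  carrier := {f | ∃ F : X → ℂ, IsHolomorphicOn N F U ∧ ∀ x : U, f x = F x}
  add_mem' := by
    rintro f g ⟨F, hF, hf⟩ ⟨G, hG, hg⟩
    exact ⟨F + G, hF.add hG, fun x => by simp [hf, hg]⟩
  mul_mem' := by
    rintro f g ⟨F, hF, hf⟩ ⟨G, hG, hg⟩
    exact ⟨F * G, hF.mul hG, fun x => by simp [hf, hg]⟩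
  algebraMap_mem' := fun c => ⟨fun _ => c, isHolomorphicOn_const c _, fun _ => rfl⟩

variable (N) in
/-- `𝒪_{X,p}`: the ring of germs at `p` of holomorphic functions. -/
def holGerms (p : X) : Subring ((𝓝 p).Germ ℂ) where
  carrier := {g | ∃ (F : X → ℂ) (U : Set X), IsOpen U ∧ p ∈ U ∧ IsHolomorphicOn N F U ∧ g = ↑F}
  add_mem' := by
    rintro _ _ ⟨F, U, hU, hpU, hF, rfl⟩ ⟨G, V, hV, hpV, hG, rfl⟩
    exact ⟨F + G, U ∩ V, hU.inter hV, ⟨hpU, hpV⟩,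
      (hF.mono inter_subset_left).add (hG.mono inter_subset_right), rfl⟩
  mul_mem' := by
    rintro _ _ ⟨F, U, hU, hpU, hF, rfl⟩ ⟨G, V, hV, hpV, hG, rfl⟩
    exact ⟨F * G, U ∩ V, hU.inter hV, ⟨hpU, hpV⟩,
      (hF.mono inter_subset_left).mul (hG.mono inter_subset_right), rfl⟩
  zero_mem' := ⟨fun _ => 0, univ, isOpen_univ, mem_univ p, isHolomorphicOn_const 0 _, rfl⟩
  one_mem' := ⟨fun _ => 1, univ, isOpen_univ, mem_univ p, isHolomorphicOn_const 1 _, rfl⟩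
  neg_mem' := by
    rintro _ ⟨F, U, hU, hpU, hF, rfl⟩
    refine ⟨(fun _ => -1) * F, U, hU, hpU, (isHolomorphicOn_const (-1) _).mul hF, ?_⟩
    rw [← Germ.coe_neg]
    congr 1
    ext x
    simp

end Rings

section CRRings

variable {n k : ℕ} {M : Type*} [TopologicalSpace M]
  [ChartedSpace (RModel (2 * n + k)) M] [IsManifold (𝓡 (2 * n + k)) ∞ M] {S : CRStructure n k M}

theorem IsCROn.mono {u : M → ℂ} {U V : Set M} (hu : IsCROn S u U) (h : V ⊆ U) : IsCROn S u V :=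
  ⟨hu.smooth.mono h, fun x hx => hu.dbar x (h hx)⟩

theorem IsCROn.hasMFDerivAt {u : M → ℂ} {U : Set M} (hu : IsCROn S u U) (hU : IsOpen U)
    {x : M} (hx : x ∈ U) :
    HasMFDerivAt (𝓡 (2 * n + k)) 𝓘(ℝ, ℂ) u x (complexDifferential u x) :=
  ((hu.smooth.contMDiffAt (hU.mem_nhds hx)).mdifferentiableAt (by simp)).hasMFDerivAt

theorem IsCROn.add {u v : M → ℂ} {U : Set M} (hU : IsOpen U) (hu : IsCROn S u U)
    (hv : IsCROn S v U) : IsCROn S (u + v) U := by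
  refine ⟨hu.smooth.add hv.smooth, fun x hx A B h => ?_⟩
  have h1 : complexDifferential (u + v) x
      = complexDifferential u x + complexDifferential v x :=
    ((hu.hasMFDerivAt hU hx).add (hv.hasMFDerivAt hU hx)).mfderiv
  have h2 := hu.dbar x hx A B h
  have h3 := hv.dbar x hx A B h
  simp only [h1, add_apply]
  linear_combination h2 + h3

theorem IsCROn.mul {u v : M → ℂ} {U : Set M} (hU : IsOpen U) (hu : IsCROn S u U)
    (hv : IsCROn S v U) : IsCROn S (u * v) U := by
  have hs : ContMDiffOn (𝓡 (2 * n + k)) 𝓘(ℝ, ℂ) ∞ (u * v) U := by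
    intro x hx
    have h : ContMDiff 𝓘(ℝ, ℂ × ℂ) 𝓘(ℝ, ℂ) ∞ (fun p : ℂ × ℂ => p.1 * p.2) :=
      contDiff_mul.contMDiff
    exact (h.contMDiffAt (x := (u x, v x))).comp_contMDiffWithinAt (f := fun y => (u y, v y)) x
      ((hu.smooth x hx).prodMk_space (hv.smooth x hx))
  refine ⟨hs, fun x hx A B h => ?_⟩
  have h1 : complexDifferential (u * v) x
      = u x • complexDifferential v x + v x • complexDifferential u x :=
    ((hu.hasMFDerivAt hU hx).mul (hv.hasMFDerivAt hU hx)).mfderiv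
  have h2 := hu.dbar x hx A B h
  have h3 := hv.dbar x hx A B h
  simp only [h1, add_apply, smul_apply, smul_eq_mul]
  linear_combination v x * h2 + u x * h3

theorem isCROn_const (c : ℂ) (U : Set M) : IsCROn S (fun _ => c) U := by
  refine ⟨contMDiffOn_const, fun x hx A B h => ?_⟩
  have h1 : complexDifferential (d := 2 * n + k) (fun _ : M => c) x = 0 := mfderiv_const
  simp [h1]

variable (S)

/-- `𝒞ℛ(U)`: the algebra of smooth CR functions on the open set `U`. -/
def crFunctions (U : TopologicalSpace.Opens M) : Subalgebra ℂ (U → ℂ) where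
  carrier := {f | ∃ u : M → ℂ, IsCROn S u U ∧ ∀ x : U, f x = u x}
  add_mem' := by
    rintro f g ⟨F, hF, hf⟩ ⟨G, hG, hg⟩
    exact ⟨F + G, hF.add U.isOpen hG, fun x => by simp [hf, hg]⟩
  mul_mem' := by
    rintro f g ⟨F, hF, hf⟩ ⟨G, hG, hg⟩
    exact ⟨F * G, hF.mul U.isOpen hG, fun x => by simp [hf, hg]⟩
  algebraMap_mem' := fun c => ⟨fun _ => c, isCROn_const c _, fun _ => rfl⟩

/-- `𝒞ℛ_{M,a}`: the ring of germs at `a` of smooth CR functions. -/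
def crGerms (a : M) : Subring ((𝓝 a).Germ ℂ) where
  carrier := {g | ∃ (u : M → ℂ) (U : Set M), IsOpen U ∧ a ∈ U ∧ IsCROn S u U ∧ g = ↑u}
  add_mem' := by
    rintro _ _ ⟨F, U, hU, hpU, hF, rfl⟩ ⟨G, V, hV, hpV, hG, rfl⟩
    exact ⟨F + G, U ∩ V, hU.inter hV, ⟨hpU, hpV⟩,
      (hF.mono inter_subset_left).add (hU.inter hV) (hG.mono inter_subset_right), rfl⟩
  mul_mem' := by
    rintro _ _ ⟨F, U, hU, hpU, hF, rfl⟩ ⟨G, V, hV, hpV, hG, rfl⟩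
    exact ⟨F * G, U ∩ V, hU.inter hV, ⟨hpU, hpV⟩,
      (hF.mono inter_subset_left).mul (hU.inter hV) (hG.mono inter_subset_right), rfl⟩
  zero_mem' := ⟨fun _ => 0, univ, isOpen_univ, mem_univ a, isCROn_const 0 _, rfl⟩
  one_mem' := ⟨fun _ => 1, univ, isOpen_univ, mem_univ a, isCROn_const 1 _, rfl⟩
  neg_mem' := by
    rintro _ ⟨F, U, hU, hpU, hF, rfl⟩
    refine ⟨(fun _ => -1) * F, U, hU, hpU, (isCROn_const (-1) _).mul hU hF, ?_⟩
    rw [← Germ.coe_neg]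
    congr 1
    ext x
    simp

end CRRings

section Restriction

variable {n k N : ℕ} {M X : Type*} [TopologicalSpace M]
  [ChartedSpace (RModel (2 * n + k)) M] [IsManifold (𝓡 (2 * n + k)) ∞ M]
  [TopologicalSpace X] [ChartedSpace (CModel N) X] {S : CRStructure n k M} {φ : M → X}

/-- The pullback of a holomorphic function by a CR map is a CR function. -/
theorem IsCRMap.isCROn_comp (hφ : IsCRMap N S φ) {F : X → ℂ} {V : Set X} (hV : IsOpen V)
    (hF : IsHolomorphicOn N F V) : IsCROn S (F ∘ φ) (φ ⁻¹' V) := by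
  refine ⟨fun x hx => ((hF.contMDiffAt_real hV hx).comp x
    hφ.smooth.contMDiffAt).contMDiffWithinAt, ?_⟩
  rintro x hx A _ ⟨hA, rfl⟩
  have hd : complexDifferential (F ∘ φ) x = (mfderiv 𝓘(ℝ, CModel N) 𝓘(ℝ, ℂ) F (φ x)).comp
      (mfderiv (𝓡 (2 * n + k)) 𝓘(ℝ, CModel N) φ x) :=
    mfderiv_comp x ((hF.contMDiffAt_real hV hx).mdifferentiableAt (by simp))
      (hφ.smooth.contMDiffAt.mdifferentiableAt (by simp))
  have h1 := hφ.map_J x ⟨A, hA⟩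
  have h2 := hF.mfderiv_complexJ hV hx (mfderiv (𝓡 (2 * n + k)) 𝓘(ℝ, CModel N) φ x A)
  have h3 : complexDifferential (F ∘ φ) x (S.J x ⟨A, hA⟩ : TangentSpace (𝓡 (2 * n + k)) x)
      = Complex.I * complexDifferential (F ∘ φ) x A := by
    rw [hd]
    exact (congrArg (mfderiv 𝓘(ℝ, CModel N) 𝓘(ℝ, ℂ) F (φ x)) h1).trans h2
  rw [h3, ← mul_assoc, Complex.I_mul_I]
  ring

/-- The restriction homomorphism `r : 𝒪(Ω) → 𝒞ℛ(W)`, `f ↦ f ∘ φ`, for `φ (W) ⊆ Ω`. -/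
def IsCRMap.restrict (hφ : IsCRMap N S φ) (Ω : TopologicalSpace.Opens X)
    (W : TopologicalSpace.Opens M) (h : ∀ x ∈ W, φ x ∈ Ω) :
    holFunctions N Ω →ₐ[ℂ] crFunctions S W where
  toFun f := ⟨fun x => (f : Ω → ℂ) ⟨φ x, h x x.2⟩, by
    obtain ⟨f, F, hF, hf⟩ := f
    exact ⟨F ∘ φ, (hφ.isCROn_comp Ω.isOpen hF).mono h, fun x => hf _⟩⟩
  map_one' := rfl
  map_mul' _ _ := rfl
  map_zero' := rfl
  map_add' _ _ := rfl
  commutes' _ := rfl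

/-- The restriction homomorphism of germs `𝒪_{X, φ a} → 𝒞ℛ_{M, a}`, `f ↦ f ∘ φ`. -/
def IsCRMap.restrictGerm (hφ : IsCRMap N S φ) (a : M) : holGerms N (φ a) →+* crGerms S a where
  toFun g := ⟨(g : (𝓝 (φ a)).Germ ℂ).compTendsto φ hφ.smooth.continuous.continuousAt, by
    obtain ⟨_, F, U, hU, ha, hF, rfl⟩ := g
    exact ⟨F ∘ φ, φ ⁻¹' U, hU.preimage hφ.smooth.continuous, ha, hφ.isCROn_comp hU hF, rfl⟩⟩
  map_one' := rfl
  map_mul' := by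
    rintro ⟨_, F, U, hU, ha, hF, rfl⟩ ⟨_, G, V, hV, hb, hG, rfl⟩
    rfl
  map_zero' := rfl
  map_add' := by
    rintro ⟨_, F, U, hU, ha, hF, rfl⟩ ⟨_, G, V, hV, hb, hG, rfl⟩
    rfl

variable (N) in
/-- `(M, X)` is an `E`-pair, where the CR manifold `M` is a generic CR submanifold of `X` by means
of `φ`: restriction induces an isomorphism `𝒪_{X, φ a} → 𝒞ℛ_{M, a}` for each `a`. -/
structure IsEPair (S : CRStructure n k M) (φ : M → X) : Prop
    extends IsGenericCREmbedding N S φ where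
  germ_bijective : ∀ a : M, Function.Bijective (toIsCRMap.restrictGerm a)

end Restriction

end

/-!
The germ isomorphism extends each CR function `u` on `W` to a holomorphic function near each point
of `φ (W)`; the point is to find one neighbourhood that serves all `u` at once.

*Uniform radius* (`IsEPair.exists_uniform_radius`). Suppose that at `a ∈ W` no radius serves all CR
functions, and let `u_m` be CR on `W` without extension to the ball of radius `r_m` about `φ a`, where
`r_m → 0`. For small `ε_m > 0` the series `∑ t_m ε_m u_m` converges, with all derivatives, to a CR
function near `a` for every `t` in the compact cube `[0, 1]^ℕ`. Let `A_m` be the set of those `t` for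
which the sum is given, on a fixed connected neighbourhood of `a`, by a power series whose
coefficients obey the `m`-th Cauchy bound. By Tychonoff's theorem, `A_m` is the projection of a
compact set, hence closed; by surjectivity on germs and unique continuation the `A_m` cover the cube.
By Baire's theorem some `A_m` contains a nonempty open set, so all but finitely many coordinates can
be moved freely inside `A_m`. Moving one coordinate `j ≥ m` shows that `u_j` extends to the ball of
radius `r_m ≥ r_j`, a contradiction. Working on the cube replaces the Fréchet space of CR functions.

*Unique continuation* (`IsEPair.eqOn_zero_of_isPreconnected`). A CR function with a zero germ vanishes
on every connected open set about the point: at a point of the boundary of its zero set, extend it to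
a holomorphic function, whose germ is zero somewhere nearby by injectivity on germs.

*Gluing.* `M` is connected and paracompact, hence σ-compact, so `φ (M)` has a second countable, hence
metrizable, neighbourhood in `X`. Replacing the neighbourhoods of the points `φ a` by balls of a third
of the radius, two that meet are such that one lies in the original domain about the other centre
(`exists_open_nhds_subset_or_subset`). The local extensions of `u` therefore agree wherever two of
them are defined, by the identity theorem on small neighbourhoods of the points `φ a`. Their union is
`Ω`, and injectivity of the restriction to `W` follows from the same identity theorem.
-/

/-! ### Topology of manifolds -/

/-- Start from a point and a locally finite cover by relatively compact open sets, and iterate the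
passage from a compact set to the union of the closures of the members of the cover that it meets:
the union of the compact sets so obtained is open and closed. -/
theorem sigmaCompactSpace_of_connected_paracompact (M : Type*) [TopologicalSpace M]
    [T2Space M] [ParacompactSpace M] [LocallyCompactSpace M] [ConnectedSpace M] :
    SigmaCompactSpace M := by
  classical
  choose K hK hxK using fun x : M => exists_compact_mem_nhds x
  obtain ⟨u, huo, hucov, hulf, huK⟩ := precise_refinement (fun x => interior (K x))
    (fun x => isOpen_interior)
    (iUnion_eq_univ_iff.2 fun x => ⟨x, mem_interior_iff_mem_nhds.2 (hxK x)⟩)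
  have hcl : ∀ i, IsCompact (closure (u i)) := fun i =>
    (hK i).of_isClosed_subset isClosed_closure
      (closure_minimal ((huK i).trans interior_subset) (hK i).isClosed)
  have hfin : ∀ C : Set M, IsCompact C → {i | (u i ∩ C).Nonempty}.Finite := fun C hC =>
    hulf.finite_nonempty_inter_compact hC
  let next : Set M → Set M := fun C => ⋃ i ∈ {i | (u i ∩ C).Nonempty}, closure (u i)
  have hnext : ∀ C, IsCompact C → IsCompact (next C) := fun C hC =>
    (hfin C hC).isCompact_biUnion fun i _ => hcl i
  obtain ⟨x₀⟩ := (inferInstance : Nonempty M)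
  let A : ℕ → Set M := fun n => next^[n] {x₀}
  have hA : ∀ n, IsCompact (A n) := by
    intro n
    induction n with
    | zero => exact isCompact_singleton
    | succ n ih =>
      simp only [A, Function.iterate_succ_apply']
      exact hnext _ ih
  have hstep : ∀ n i, (u i ∩ A n).Nonempty → u i ⊆ A (n + 1) := by
    intro n i h
    simp only [A, Function.iterate_succ_apply']
    exact subset_closure.trans (subset_biUnion_of_mem (u := fun i => closure (u i)) h)
  have hkey : ∀ i, (u i ∩ ⋃ n, A n).Nonempty → u i ⊆ ⋃ n, A n := by
    rintro i ⟨x, hxi, hxA⟩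
    obtain ⟨n, hn⟩ := mem_iUnion.1 hxA
    exact (hstep n i ⟨x, hxi, hn⟩).trans (subset_iUnion A (n + 1))
  have hcov : ∀ x, ∃ i, x ∈ u i := iUnion_eq_univ_iff.1 hucov
  have hclopen : IsClopen (⋃ n, A n) := by
    constructor
    · rw [← isOpen_compl_iff, isOpen_iff_mem_nhds]
      intro x hx
      obtain ⟨i, hi⟩ := hcov x
      refine mem_of_superset ((huo i).mem_nhds hi) fun y hy hyA => ?_
      exact hx (hkey i ⟨y, hy, hyA⟩ hi)
    · rw [isOpen_iff_mem_nhds]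
      intro x hx
      obtain ⟨i, hi⟩ := hcov x
      exact mem_of_superset ((huo i).mem_nhds hi) (hkey i ⟨x, hi, hx⟩)
  have huniv : (⋃ n, A n) = univ :=
    hclopen.eq_univ ⟨x₀, mem_iUnion.2 ⟨0, rfl⟩⟩
  exact ⟨⟨A, hA, huniv⟩⟩

theorem exists_nhds_subset_or_subset {Y ι : Type*} [PseudoMetricSpace Y] (p : ι → Y)
    (O : ι → Set Y) (hO : ∀ i, O i ∈ 𝓝 (p i)) :
    ∃ V : ι → Set Y, (∀ i, IsOpen (V i)) ∧ (∀ i, p i ∈ V i) ∧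
      ∀ i j, (V i ∩ V j).Nonempty → V j ⊆ O i ∨ V i ⊆ O j := by
  choose ε hε hεO using fun i => Metric.mem_nhds_iff.1 (hO i)
  have key : ∀ i j, (Metric.ball (p i) (ε i / 3) ∩ Metric.ball (p j) (ε j / 3)).Nonempty →
      ε j ≤ ε i → Metric.ball (p j) (ε j / 3) ⊆ O i := by
    rintro i j ⟨z, hzi, hzj⟩ h y hy
    apply hεO i
    rw [Metric.mem_ball] at *
    have h1 := dist_triangle y (p j) (p i)
    have h2 := dist_triangle (p j) z (p i)
    rw [dist_comm (p j) z] at h2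
    linarith
  refine ⟨fun i => Metric.ball (p i) (ε i / 3), fun i => Metric.isOpen_ball,
    fun i => Metric.mem_ball_self (by linarith [hε i]), fun i j h => ?_⟩
  rcases le_total (ε j) (ε i) with h' | h'
  · exact Or.inl (key i j h h')
  · exact Or.inr (key j i (by rwa [inter_comm]) h')

/-- Points in the image of a σ-compact space have neighbourhoods so small that, of any two
that meet, one lies in the prescribed neighbourhood `O` of the centre of the other. The metric for
this lives on an open neighbourhood of the image: `X` itself need not be second countable. -/
theorem exists_open_nhds_subset_or_subset {H X P : Type*} [TopologicalSpace H]
    [SecondCountableTopology H] [TopologicalSpace X] [ChartedSpace H X] [T3Space X]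
    [TopologicalSpace P] [SigmaCompactSpace P] {φ : P → X} (hφ : Continuous φ)
    {ι : Type*} (p : ι → P) (O : ι → Set X) (hO : ∀ i, O i ∈ 𝓝 (φ (p i))) :
    ∃ V : ι → Set X, (∀ i, IsOpen (V i)) ∧ (∀ i, φ (p i) ∈ V i) ∧
      ∀ i j, (V i ∩ V j).Nonempty → V j ⊆ O i ∨ V i ⊆ O j := by
  obtain ⟨s, hs, hsP⟩ := countable_cover_nhds_of_sigmaCompact
    (f := fun x : P => φ ⁻¹' (chartAt H (φ x)).source)
    fun x => hφ.continuousAt.preimage_mem_nhds (chart_source_mem_nhds H _)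
  let Y : Set X := ⋃ x ∈ s, (chartAt H (φ x)).source
  have hYo : IsOpen Y := isOpen_biUnion fun x _ => (chartAt H (φ x)).open_source
  have hPY : ∀ x, φ x ∈ Y := by
    intro x
    have : x ∈ ⋃ x ∈ s, φ ⁻¹' (chartAt H (φ x)).source := hsP ▸ mem_univ x
    simpa [Y] using this
  have : SecondCountableTopology Y := by
    have : Countable s := hs.to_subtype
    have hsc : ∀ x : s, SecondCountableTopology
        (Subtype.val ⁻¹' (chartAt H (φ x)).source : Set Y) := by
      intro x
      have := (chartAt H (φ x)).secondCountableTopology_source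
      have hmaps : ∀ z : (Subtype.val ⁻¹' (chartAt H (φ x)).source : Set Y),
          (z : X) ∈ (chartAt H (φ x)).source := fun z => z.2
      refine IsEmbedding.secondCountableTopology
        (f := fun z => (⟨z, hmaps z⟩ : (chartAt H (φ x)).source)) ?_
      refine IsEmbedding.of_comp (g := Subtype.val) (by fun_prop) continuous_subtype_val ?_
      exact (IsEmbedding.subtypeVal (p := (· ∈ Y))).comp IsEmbedding.subtypeVal
    refine TopologicalSpace.secondCountableTopology_of_countable_cover
      (U := fun x : s => (Subtype.val ⁻¹' (chartAt H (φ x)).source : Set Y))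
      (fun x => (chartAt H (φ x)).open_source.preimage continuous_subtype_val) ?_
    refine iUnion_eq_univ_iff.2 fun y => ?_
    obtain ⟨x, hx, hy⟩ := mem_iUnion₂.1 y.2
    exact ⟨⟨x, hx⟩, hy⟩
  let _ : MetricSpace Y := TopologicalSpace.metrizableSpaceMetric Y
  obtain ⟨V, hVo, hpV, hV⟩ := exists_nhds_subset_or_subset
    (fun i => (⟨φ (p i), hPY _⟩ : Y)) (fun i => Subtype.val ⁻¹' O i)
    fun i => continuous_subtype_val.continuousAt.preimage_mem_nhds (hO i)
  refine ⟨fun i => Subtype.val '' V i, fun i => hYo.isOpenMap_subtype_val _ (hVo i),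
    fun i => ⟨_, hpV i, rfl⟩, fun i j h => ?_⟩
  rw [← image_inter Subtype.val_injective, image_nonempty] at h
  simpa only [image_subset_iff] using hV i j h

/-! ### Identity theorem and unique continuation -/

section Holomorphic

variable {N : ℕ} {X : Type*} [TopologicalSpace X] [ChartedSpace (CModel N) X]
  [IsManifold 𝓘(ℂ, CModel N) ω X]

theorem IsHolomorphicOn.analyticOnNhd_comp_symm {F : X → ℂ} {U : Set X}
    (hF : IsHolomorphicOn N F U) (hU : IsOpen U) (p : X) :
    AnalyticOnNhd ℂ (F ∘ (extChartAt 𝓘(ℂ, CModel N) p).symm)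
      ((extChartAt 𝓘(ℂ, CModel N) p).target ∩ (extChartAt 𝓘(ℂ, CModel N) p).symm ⁻¹' U) := by
  have ho : IsOpen ((extChartAt 𝓘(ℂ, CModel N) p).target ∩
      (extChartAt 𝓘(ℂ, CModel N) p).symm ⁻¹' U) :=
    (continuousOn_extChartAt_symm p).isOpen_inter_preimage (isOpen_extChartAt_target p) hU
  have h1 : ContMDiffOn 𝓘(ℂ, CModel N) 𝓘(ℂ, ℂ) ω (F ∘ (extChartAt 𝓘(ℂ, CModel N) p).symm)
      ((extChartAt 𝓘(ℂ, CModel N) p).target ∩ (extChartAt 𝓘(ℂ, CModel N) p).symm ⁻¹' U) :=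
    ContMDiffOn.comp hF ((contMDiffOn_extChartAt_symm p).mono inter_subset_left)
      inter_subset_right
  rw [contMDiffOn_iff_contDiffOn, contDiffOn_omega_iff_analyticOn ho.uniqueDiffOn,
    ho.analyticOn_iff_analyticOnNhd] at h1
  exact h1

theorem isHolomorphicOn_comp_extChartAt {f : CModel N → ℂ} {s : Set (CModel N)}
    (hf : AnalyticOnNhd ℂ f s) (p : X) :
    IsHolomorphicOn N (f ∘ extChartAt 𝓘(ℂ, CModel N) p)
      ((extChartAt 𝓘(ℂ, CModel N) p).source ∩ extChartAt 𝓘(ℂ, CModel N) p ⁻¹' s) := by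
  have h1 : ContMDiffOn 𝓘(ℂ, CModel N) 𝓘(ℂ, ℂ) ω f s :=
    contMDiffOn_iff_contDiffOn.2 hf.contDiffOn_of_completeSpace
  refine h1.comp ((contMDiffOn_extChartAt (x := p)).mono ?_) inter_subset_right
  rw [extChartAt_source]
  exact inter_subset_left

/-- The identity theorem on a basis of neighbourhoods of `p`, the preimages of balls in the chart. -/
theorem exists_nhd_identity (p : X) {O : Set X} (hO : O ∈ 𝓝 p) :
    ∃ V : Set X, IsOpen V ∧ p ∈ V ∧ V ⊆ O ∧ ∀ F : X → ℂ, IsHolomorphicOn N F V →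
      ∀ q ∈ V, F =ᶠ[𝓝 q] 0 → EqOn F 0 V := by
  set ψ := extChartAt 𝓘(ℂ, CModel N) p with hψ
  have h1 : ψ.target ∩ ψ.symm ⁻¹' O ∈ 𝓝 (ψ p) :=
    inter_mem (extChartAt_target_mem_nhds p) (extChartAt_preimage_mem_nhds hO)
  obtain ⟨r, hr, hrO⟩ := Metric.mem_nhds_iff.1 h1
  have hVo : IsOpen (ψ.source ∩ ψ ⁻¹' Metric.ball (ψ p) r) :=
    (continuousOn_extChartAt p).isOpen_inter_preimage (isOpen_extChartAt_source p)
      Metric.isOpen_ball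
  have hback : Metric.ball (ψ p) r ⊆
      ψ.target ∩ ψ.symm ⁻¹' (ψ.source ∩ ψ ⁻¹' Metric.ball (ψ p) r) := by
    intro z hz
    have hz' := (hrO hz).1
    exact ⟨hz', ψ.map_target hz', by rwa [mem_preimage, ψ.right_inv hz']⟩
  refine ⟨_, hVo, ⟨mem_extChartAt_source p, Metric.mem_ball_self hr⟩, ?_, ?_⟩
  · rintro x ⟨hx, hxr⟩
    have := (hrO hxr).2
    rwa [mem_preimage, ψ.left_inv hx] at this
  · intro F hF q hq h0 x hx
    have hA := (hF.analyticOnNhd_comp_symm hVo p).mono hback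
    have hq0 : F ∘ ψ.symm =ᶠ[𝓝 (ψ q)] 0 := by
      have hc : ContinuousAt ψ.symm (ψ q) := continuousAt_extChartAt_symm' hq.1
      have hc' : Tendsto ψ.symm (𝓝 (ψ q)) (𝓝 q) := by
        have := hc.tendsto
        rwa [ψ.left_inv hq.1] at this
      exact hc'.eventually h0
    have := hA.eqOn_zero_of_preconnected_of_eventuallyEq_zero
      (convex_ball (ψ p) r).isPreconnected hq.2 hq0 hx.2
    rwa [Function.comp_apply, ψ.left_inv hx.1] at this

end Holomorphic

section Germs

variable {n k N : ℕ} {M X : Type*} [TopologicalSpace M]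
  [ChartedSpace (RModel (2 * n + k)) M] [IsManifold (𝓡 (2 * n + k)) ∞ M]
  [TopologicalSpace X] [ChartedSpace (CModel N) X] {S : CRStructure n k M} {φ : M → X}

/-- Injectivity of the restriction of germs, for representatives. -/
theorem IsEPair.eventuallyEq_zero (hE : IsEPair N S φ) {a : M} {F : X → ℂ} {V : Set X}
    (hV : IsOpen V) (ha : φ a ∈ V) (hF : IsHolomorphicOn N F V) (h : F ∘ φ =ᶠ[𝓝 a] 0) :
    F =ᶠ[𝓝 (φ a)] 0 := by
  let g : holGerms N (φ a) := ⟨(F : (𝓝 (φ a)).Germ ℂ), F, V, hV, ha, hF, rfl⟩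
  have hg : hE.toIsCRMap.restrictGerm a g = hE.toIsCRMap.restrictGerm a 0 :=
    Subtype.ext (Germ.coe_eq.2 h)
  exact Germ.coe_eq.1 (congrArg Subtype.val ((hE.germ_bijective a).1 hg))

/-- Surjectivity of the restriction of germs, for representatives. -/
theorem IsEPair.exists_extension (hE : IsEPair N S φ) {a : M} {u : M → ℂ} {U : Set M}
    (hU : IsOpen U) (ha : a ∈ U) (hu : IsCROn S u U) :
    ∃ (F : X → ℂ) (V : Set X), IsOpen V ∧ φ a ∈ V ∧ IsHolomorphicOn N F V ∧
      F ∘ φ =ᶠ[𝓝 a] u := by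
  obtain ⟨⟨_, F, V, hV, ha, hF, rfl⟩, hg⟩ :=
    (hE.germ_bijective a).2 ⟨(u : (𝓝 a).Germ ℂ), u, U, hU, ha, hu, rfl⟩
  exact ⟨F, V, hV, ha, hF, Germ.coe_eq.1 (congrArg Subtype.val hg)⟩

/-- Two holomorphic functions that agree on `M` near one point agree on any open set `V` on which the
identity theorem `hid` holds. -/
theorem IsEPair.eqOn_of_comp_eventuallyEq (hE : IsEPair N S φ) {V : Set X} (hV : IsOpen V)
    (hid : ∀ F : X → ℂ, IsHolomorphicOn N F V → ∀ q ∈ V, F =ᶠ[𝓝 q] 0 → EqOn F 0 V)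
    {F G : X → ℂ} (hF : IsHolomorphicOn N F V) (hG : IsHolomorphicOn N G V) {b : M}
    (hb : φ b ∈ V) (h : F ∘ φ =ᶠ[𝓝 b] G ∘ φ) : EqOn F G V := by
  have hd : IsHolomorphicOn N (F + (fun _ => -1) * G) V :=
    hF.add ((isHolomorphicOn_const (-1) V).mul hG)
  have h0 : (F + (fun _ => -1) * G) ∘ φ =ᶠ[𝓝 b] 0 := by
    filter_upwards [h] with x hx
    have hx' : F (φ x) = G (φ x) := hx
    simp [hx']
  intro x hx
  have h1 : F x + -1 * G x = 0 := hid _ hd _ hb (hE.eventuallyEq_zero hV hb hd h0) hx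
  linear_combination h1

/-- Unique continuation for CR functions: the set of zero germs of `u` is closed in `U`, because near
a limit point `u` extends holomorphically. -/
theorem IsEPair.eqOn_zero_of_isPreconnected [IsManifold 𝓘(ℂ, CModel N) ω X]
    (hE : IsEPair N S φ) {u : M → ℂ} {U : Set M} (hU : IsOpen U) (hUc : IsPreconnected U)
    (hu : IsCROn S u U) {a : M} (ha : a ∈ U) (h0 : u =ᶠ[𝓝 a] 0) : EqOn u 0 U := by
  have hsub : U ⊆ {x | u =ᶠ[𝓝 x] 0} := by
    refine hUc.subset_of_closure_inter_subset (isOpen_setOfPred_eventually_nhds) ⟨a, ha, h0⟩ ?_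
    rintro b ⟨hb, hbU⟩
    obtain ⟨F, V, hV, hbV, hF, hFu⟩ := hE.exists_extension hU hbU hu
    obtain ⟨V', hV', hbV', hV'V, hid⟩ := exists_nhd_identity (N := N) (φ b) (hV.mem_nhds hbV)
    have hF' := hF.mono hV'V
    have hcont := hE.toIsCRMap.smooth.continuous
    have hev : ∀ᶠ c in 𝓝 b, F ∘ φ =ᶠ[𝓝 c] u ∧ φ c ∈ V' :=
      hFu.eventuallyEq_nhds.and (hcont.continuousAt.eventually (hV'.mem_nhds hbV'))
    obtain ⟨c, hc0, hc, hcV⟩ := ((mem_closure_iff_frequently.1 hb).and_eventually hev).exists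
    have hFc : F =ᶠ[𝓝 (φ c)] 0 := hE.eventuallyEq_zero hV' hcV hF' (hc.trans hc0)
    have hF0 := hid F hF' _ hcV hFc
    filter_upwards [hFu, hev] with x hx hx'
    rw [← hx]
    exact hF0 hx'.2
  exact fun x hx => (hsub hx).self_of_nhds

end Germs

/-! ### Series of smooth functions and of CR functions -/

section Smooth

/-- Near `a`, every smooth function on `W` is in the chart the restriction of a compactly supported
smooth function on the model space; the neighbourhood `U` does not depend on the function. -/
theorem exists_contDiff_eqOn_extChartAt {d : ℕ} {M : Type*} [TopologicalSpace M]
    [ChartedSpace (RModel d) M] [IsManifold (𝓡 d) ∞ M] (a : M) {W : Set M} (hW : W ∈ 𝓝 a) :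
    ∃ U : Set M, IsOpen U ∧ a ∈ U ∧ U ⊆ W ∧ U ⊆ (extChartAt (𝓡 d) a).source ∧
      ∀ u : M → ℂ, ContMDiffOn (𝓡 d) 𝓘(ℝ, ℂ) ∞ u W →
        ∃ g : RModel d → ℂ, ContDiff ℝ ∞ g ∧ HasCompactSupport g ∧
          ∀ x ∈ U, g (extChartAt (𝓡 d) a x) = u x := by
  set e := extChartAt (𝓡 d) a with he
  obtain ⟨W', hW'W, hW'o, haW'⟩ := mem_nhds_iff.1 hW
  have hOo : IsOpen (e.target ∩ e.symm ⁻¹' W') :=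
    (continuousOn_extChartAt_symm a).isOpen_inter_preimage (isOpen_extChartAt_target a) hW'o
  have haO : e a ∈ e.target ∩ e.symm ⁻¹' W' :=
    ⟨mem_extChartAt_target a, by rwa [mem_preimage, extChartAt_to_inv]⟩
  obtain ⟨r, hr, hrO⟩ := Metric.nhds_basis_closedBall.mem_iff.1 (hOo.mem_nhds haO)
  let χ : ContDiffBump (e a) := ⟨r / 2, r, by linarith, by linarith⟩
  refine ⟨e.source ∩ e ⁻¹' Metric.ball (e a) (r / 2),
    (continuousOn_extChartAt a).isOpen_inter_preimage (isOpen_extChartAt_source a)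
      Metric.isOpen_ball, ⟨mem_extChartAt_source a, Metric.mem_ball_self (by linarith)⟩, ?_,
      inter_subset_left, ?_⟩
  · rintro x ⟨hx, hxr⟩
    have : e x ∈ Metric.closedBall (e a) r :=
      Metric.ball_subset_closedBall (Metric.ball_subset_ball (by linarith) hxr)
    have := (hrO this).2
    rw [mem_preimage, e.left_inv hx] at this
    exact hW'W this
  · intro u hu
    have h1 : ContDiffOn ℝ ∞ (u ∘ e.symm) (e.target ∩ e.symm ⁻¹' W') := by
      rw [← contMDiffOn_iff_contDiffOn]
      exact (hu.mono hW'W).comp ((contMDiffOn_extChartAt_symm a).mono inter_subset_left)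
        inter_subset_right
    refine ⟨fun z => χ z • (u ∘ e.symm) z, ?_, χ.hasCompactSupport.smul_right, ?_⟩
    · rw [contDiff_iff_contDiffAt]
      intro z
      by_cases hz : z ∈ e.target ∩ e.symm ⁻¹' W'
      · exact χ.contDiff.contDiffAt.smul (h1.contDiffAt (hOo.mem_nhds hz))
      · have hz' : z ∉ tsupport χ := fun h => hz (hrO (by rwa [χ.tsupport_eq] at h))
        refine (contDiffAt_const (c := (0 : ℂ))).congr_of_eventuallyEq ?_
        filter_upwards [notMem_tsupport_iff_eventuallyEq.1 hz'] with y hy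
        simp [hy]
    · rintro x ⟨hx, hxr⟩
      have : χ (e x) = 1 := χ.one_of_mem_closedBall (Metric.ball_subset_closedBall hxr)
      simp [this, e.left_inv hx]

variable {E : Type*} [NormedAddCommGroup E] [NormedSpace ℝ E]

/-- Countably many test functions can be scaled so that the `m`-th has its derivatives of order at most
`m + 1` bounded by `2⁻ᵐ`; the order `m + 1` keeps the first derivative bounded also for `m = 0`. -/
theorem exists_pos_forall_norm_iteratedFDeriv_smul_le (g : ℕ → E → ℂ)
    (hg : ∀ m, ContDiff ℝ ∞ (g m)) (hc : ∀ m, HasCompactSupport (g m)) :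
    ∃ ε : ℕ → ℝ, (∀ m, 0 < ε m) ∧ ∀ m k, k ≤ m + 1 → ∀ x,
      ‖iteratedFDeriv ℝ k (fun y => (ε m : ℂ) * g m y) x‖ ≤ (1 / 2 : ℝ) ^ m := by
  have hb : ∀ m k, ∃ C : ℝ, ∀ x, ‖iteratedFDeriv ℝ k (g m) x‖ ≤ C := fun m k =>
    ((hg m).continuous_iteratedFDeriv (by exact_mod_cast le_top)).bounded_above_of_compact_support
      ((hc m).iteratedFDeriv k)
  choose C hC using hb
  have hC0 : ∀ m k, 0 ≤ C m k := fun m k => (norm_nonneg _).trans (hC m k 0)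
  have hs : ∀ m, 0 < 1 + ∑ k ∈ Finset.range (m + 2), C m k := fun m =>
    add_pos_of_pos_of_nonneg one_pos (Finset.sum_nonneg fun k _ => hC0 m k)
  refine ⟨fun m => (1 / 2) ^ m / (1 + ∑ k ∈ Finset.range (m + 2), C m k),
    fun m => div_pos (by positivity) (hs m), fun m k hk x => ?_⟩
  set ε := (1 / 2 : ℝ) ^ m / (1 + ∑ k ∈ Finset.range (m + 2), C m k) with hε
  have hε0 : 0 < ε := div_pos (by positivity) (hs m)
  have h1 : (fun y => (ε : ℂ) * g m y) = ε • g m := by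
    ext y
    simp
  rw [h1, iteratedFDeriv_const_smul_apply
    (((hg m).of_le (by exact_mod_cast le_top)).contDiffAt), norm_smul, Real.norm_of_nonneg hε0.le]
  have h2 : C m k ≤ 1 + ∑ k ∈ Finset.range (m + 2), C m k := by
    have := Finset.single_le_sum (f := C m) (fun k _ => hC0 m k)
      (Finset.mem_range.2 (by omega : k < m + 2))
    linarith
  calc ε * ‖iteratedFDeriv ℝ k (g m) x‖
      ≤ ε * (1 + ∑ k ∈ Finset.range (m + 2), C m k) := by
        gcongr
        exact (hC m k x).trans h2
    _ = (1 / 2) ^ m := by rw [hε, div_mul_cancel₀ _ (hs m).ne']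

theorem norm_ofReal_mul_le {t : ℝ} (ht : t ∈ Icc (0 : ℝ) 1) (z : ℂ) : ‖(t : ℂ) * z‖ ≤ ‖z‖ := by
  rw [norm_mul, Complex.norm_real, Real.norm_of_nonneg ht.1]
  exact mul_le_of_le_one_left (norm_nonneg z) ht.2

variable {v : ℕ → E → ℂ}

theorem norm_iteratedFDeriv_ofReal_mul_le (hv : ∀ m, ContDiff ℝ ∞ (v m))
    (hb : ∀ m k, k ≤ m + 1 → ∀ x, ‖iteratedFDeriv ℝ k (v m) x‖ ≤ (1 / 2 : ℝ) ^ m)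
    {t : ℕ → ℝ} (ht : ∀ m, t m ∈ Icc (0 : ℝ) 1) (m k : ℕ)
    (hk : k ≤ m + 1) (x : E) :
    ‖iteratedFDeriv ℝ k (fun y => (t m : ℂ) * v m y) x‖ ≤ (1 / 2 : ℝ) ^ m := by
  have h1 : (fun y => (t m : ℂ) * v m y) = t m • v m := by
    ext y
    simp
  rw [h1, iteratedFDeriv_const_smul_apply
    (((hv m).of_le (by exact_mod_cast le_top)).contDiffAt), norm_smul,
    Real.norm_of_nonneg (ht m).1]
  exact (mul_le_of_le_one_left (norm_nonneg _) (ht m).2).trans (hb m k hk x)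

theorem contDiff_tsum_ofReal_mul (hv : ∀ m, ContDiff ℝ ∞ (v m))
    (hb : ∀ m k, k ≤ m + 1 → ∀ x, ‖iteratedFDeriv ℝ k (v m) x‖ ≤ (1 / 2 : ℝ) ^ m)
    {t : ℕ → ℝ} (ht : ∀ m, t m ∈ Icc (0 : ℝ) 1) :
    ContDiff ℝ ∞ fun x => ∑' m, (t m : ℂ) * v m x := by
  refine contDiff_tsum_of_eventually (N := (⊤ : ℕ∞)) (v := fun _ m => (1 / 2 : ℝ) ^ m)
    (fun m => contDiff_const.mul (hv m)) (fun _ _ => summable_geometric_two) fun k _ => ?_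
  rw [Nat.cofinite_eq_atTop]
  filter_upwards [eventually_ge_atTop k] with m hm x
  exact norm_iteratedFDeriv_ofReal_mul_le hv hb ht m k (by omega) x

theorem hasSum_fderiv_tsum_ofReal_mul (hv : ∀ m, ContDiff ℝ ∞ (v m))
    (hb : ∀ m k, k ≤ m + 1 → ∀ x, ‖iteratedFDeriv ℝ k (v m) x‖ ≤ (1 / 2 : ℝ) ^ m)
    {t : ℕ → ℝ} (ht : ∀ m, t m ∈ Icc (0 : ℝ) 1) (x A : E) :
    HasSum (fun m => (t m : ℂ) * fderiv ℝ (v m) x A)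
      (fderiv ℝ (fun y => ∑' m, (t m : ℂ) * v m y) x A) := by
  have hd : ∀ m, Differentiable ℝ (v m) := fun m => (hv m).differentiable (by simp)
  have hf : ∀ m y, HasFDerivAt (fun y => (t m : ℂ) * v m y) ((t m : ℂ) • fderiv ℝ (v m) y) y :=
    fun m y => (hd m y).hasFDerivAt.const_mul _
  have hbound : ∀ m y, ‖(t m : ℂ) • fderiv ℝ (v m) y‖ ≤ (1 / 2 : ℝ) ^ m := by
    intro m y
    have := norm_iteratedFDeriv_ofReal_mul_le hv hb ht m 1 (by omega) y
    rwa [norm_iteratedFDeriv_one, (hf m y).fderiv] at this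
  have hsum0 : Summable fun m => (t m : ℂ) * v m 0 := by
    refine Summable.of_norm_bounded summable_geometric_two fun m => ?_
    have := norm_iteratedFDeriv_ofReal_mul_le hv hb ht m 0 (by omega) 0
    rwa [norm_iteratedFDeriv_zero] at this
  have h := hasFDerivAt_tsum summable_geometric_two hf hbound hsum0 x
  have hs : Summable fun m => (t m : ℂ) • fderiv ℝ (v m) x :=
    Summable.of_norm_bounded summable_geometric_two fun m => hbound m x
  rw [h.fderiv]
  have h1 := (ContinuousLinearMap.apply ℝ ℂ A).hasSum hs.hasSum
  simpa only [Function.comp_def, ContinuousLinearMap.apply_apply, smul_apply,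
    smul_eq_mul] using h1

theorem continuous_tsum_ofReal_mul
    (hb : ∀ m k, k ≤ m + 1 → ∀ x, ‖iteratedFDeriv ℝ k (v m) x‖ ≤ (1 / 2 : ℝ) ^ m) (x : E) :
    Continuous fun t : ℕ → unitInterval => ∑' m, ((t m : ℝ) : ℂ) * v m x := by
  refine continuous_tsum (fun m => by fun_prop) summable_geometric_two fun m t => ?_
  refine (norm_ofReal_mul_le (t m).2 _).trans ?_
  simpa using hb m 0 (by omega) x

end Smooth

section CR

variable {n k : ℕ} {M : Type*} [TopologicalSpace M]
  [ChartedSpace (RModel (2 * n + k)) M] [IsManifold (𝓡 (2 * n + k)) ∞ M] {S : CRStructure n k M}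

theorem IsCROn.congr {u v : M → ℂ} {U : Set M} (hU : IsOpen U) (hu : IsCROn S u U)
    (h : EqOn v u U) : IsCROn S v U := by
  refine ⟨hu.smooth.congr h, fun x hx A B hAB => ?_⟩
  have : complexDifferential (d := 2 * n + k) v x = complexDifferential u x :=
    (h.eventuallyEq_of_mem (hU.mem_nhds hx)).mfderiv_eq
  simpa only [this] using hu.dbar x hx A B hAB

/-- The tangential Cauchy–Riemann equations pass to the sum, since the series is differentiated term
by term in the chart at `a`. -/
theorem isCROn_tsum {a : M} {U : Set M} (hU : IsOpen U)
    (hUs : U ⊆ (extChartAt (𝓡 (2 * n + k)) a).source) {v : ℕ → RModel (2 * n + k) → ℂ}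
    (hv : ∀ m, ContDiff ℝ ∞ (v m))
    (hb : ∀ m k, k ≤ m + 1 → ∀ x, ‖iteratedFDeriv ℝ k (v m) x‖ ≤ (1 / 2 : ℝ) ^ m)
    (hcr : ∀ m, IsCROn S (v m ∘ extChartAt (𝓡 (2 * n + k)) a) U)
    {t : ℕ → ℝ} (ht : ∀ m, t m ∈ Icc (0 : ℝ) 1) :
    IsCROn S (fun x => ∑' m, (t m : ℂ) * v m (extChartAt (𝓡 (2 * n + k)) a x)) U := by
  set e := extChartAt (𝓡 (2 * n + k)) a with he
  have hes : ContMDiffOn (𝓡 (2 * n + k)) 𝓘(ℝ, RModel (2 * n + k)) ∞ e U :=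
    (contMDiffOn_extChartAt (x := a)).mono (by rwa [← extChartAt_source (𝓡 (2 * n + k))])
  have hd : ∀ g : RModel (2 * n + k) → ℂ, ContDiff ℝ ∞ g → ∀ x ∈ U, ∀ A,
      complexDifferential (d := 2 * n + k) (g ∘ e) x A = fderiv ℝ g (e x)
        (mfderiv (𝓡 (2 * n + k)) 𝓘(ℝ, RModel (2 * n + k)) e x A) := by
    intro g hg x hx A
    have h1 : MDifferentiableAt 𝓘(ℝ, RModel (2 * n + k)) 𝓘(ℝ, ℂ) g (e x) :=
      (hg.contMDiff.mdifferentiable (by simp)) _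
    have h2 : MDifferentiableAt (𝓡 (2 * n + k)) 𝓘(ℝ, RModel (2 * n + k)) e x :=
      (hes.contMDiffAt (hU.mem_nhds hx)).mdifferentiableAt (by simp)
    have h3 := mfderiv_comp x h1 h2
    rw [mfderiv_eq_fderiv] at h3
    exact DFunLike.congr_fun h3 A
  have hT := contDiff_tsum_ofReal_mul hv hb ht
  refine ⟨hT.contMDiff.comp_contMDiffOn hes, fun x hx A B hAB => ?_⟩
  have h1 := hasSum_fderiv_tsum_ofReal_mul hv hb ht (e x)
    (mfderiv (𝓡 (2 * n + k)) 𝓘(ℝ, RModel (2 * n + k)) e x A)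
  have h2 := hasSum_fderiv_tsum_ofReal_mul hv hb ht (e x)
    (mfderiv (𝓡 (2 * n + k)) 𝓘(ℝ, RModel (2 * n + k)) e x B)
  have h3 := h1.add (h2.mul_left Complex.I)
  rw [← hd _ hT x hx A, ← hd _ hT x hx B] at h3
  refine h3.unique ?_
  convert hasSum_zero with m
  have h4 := (hcr m).dbar x hx A B hAB
  rw [hd _ (hv m) x hx A, hd _ (hv m) x hx B] at h4
  linear_combination (t m : ℂ) * h4

end CR

/-! ### Uniform radius of extension -/

section PowerSeries

variable {E : Type*} [NormedAddCommGroup E] [NormedSpace ℂ E]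

/-- The formal power series on `E` whose `i`-th coefficient is bounded by `c * c ^ i`. This is a product
of balls, so that it is compact for the product topology when `E` is finite-dimensional. -/
def boundedSeries (E : Type*) [NormedAddCommGroup E] [NormedSpace ℂ E] (c : ℝ) :
    Set (∀ i : ℕ, E [×i]→L[ℂ] ℂ) :=
  univ.pi fun i => Metric.closedBall 0 (c * c ^ i)

/-- The sum of a formal power series at `y`, as `FormalMultilinearSeries.sum`, but for `p` in the plain
product type, which carries the product topology. -/
noncomputable def seriesSum (p : ∀ i : ℕ, E [×i]→L[ℂ] ℂ) (y : E) : ℂ := ∑' i, p i fun _ => y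

theorem mem_boundedSeries {c : ℝ} {p : ∀ i : ℕ, E [×i]→L[ℂ] ℂ} :
    p ∈ boundedSeries E c ↔ ∀ i, ‖p i‖ ≤ c * c ^ i := by
  simp [boundedSeries]

theorem isCompact_boundedSeries [FiniteDimensional ℂ E] (c : ℝ) :
    IsCompact (boundedSeries E c) := by
  refine isCompact_univ_pi fun i => ?_
  have : FiniteDimensional ℂ (E [×i]→L[ℂ] ℂ) :=
    Module.Finite.of_injective
      (ContinuousMultilinearMap.toMultilinearMapLinear (R' := ℂ) (A := ℂ)
        (M₁ := fun _ : Fin i => E) (M₂ := ℂ))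
      ContinuousMultilinearMap.toMultilinearMap_injective
  have : ProperSpace (E [×i]→L[ℂ] ℂ) := FiniteDimensional.proper ℂ _
  exact isCompact_closedBall _ _

/-- For `‖y‖ < 1 / (2c)` the series at `y` is dominated by `∑ c / 2 ^ i`, uniformly in `p`. -/
theorem continuous_seriesSum {c : ℝ} (hc : 0 < c) {y : E} (hy : ‖y‖ < 1 / (2 * c)) :
    Continuous fun p : boundedSeries E c => seriesSum (p : ∀ i : ℕ, E [×i]→L[ℂ] ℂ) y := by
  refine continuous_tsum (u := fun i => c * (1 / 2 : ℝ) ^ i) (fun i => ?_)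
    (summable_geometric_two.mul_left c) fun i p => ?_
  · exact (continuous_eval_const (F := E [×i]→L[ℂ] ℂ) (fun _ : Fin i => y)).comp
      ((continuous_apply i).comp continuous_subtype_val)
  · have h1 := mem_boundedSeries.1 p.2 i
    have h2 : c * ‖y‖ ≤ 1 / 2 := by
      rw [lt_div_iff₀ (by positivity)] at hy
      linarith
    calc ‖(p : ∀ i : ℕ, E [×i]→L[ℂ] ℂ) i fun _ => y‖
        ≤ ‖(p : ∀ i : ℕ, E [×i]→L[ℂ] ℂ) i‖ * ‖y‖ ^ i := by
          simpa using ((p : ∀ i : ℕ, E [×i]→L[ℂ] ℂ) i).le_opNorm fun _ => y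
      _ ≤ c * c ^ i * ‖y‖ ^ i := by gcongr
      _ = c * (c * ‖y‖) ^ i := by ring
      _ ≤ c * (1 / 2) ^ i := by gcongr

theorem analyticOnNhd_seriesSum_sub {c : ℝ} (hc : 0 < c) {p : ∀ i : ℕ, E [×i]→L[ℂ] ℂ}
    (hp : p ∈ boundedSeries E c) (z₀ : E) :
    AnalyticOnNhd ℂ (fun z => seriesSum p (z - z₀)) (Metric.ball z₀ (1 / (2 * c))) := by
  let q : FormalMultilinearSeries ℂ E ℂ := p
  let r : NNReal := ⟨1 / (2 * c), by positivity⟩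
  have hr0 : (0 : ENNReal) < r := by
    rw [ENNReal.coe_pos]
    exact (by positivity : 0 < 1 / (2 * c))
  have hr : (r : ENNReal) ≤ q.radius := by
    refine q.le_radius_of_bound c fun i => ?_
    calc ‖q i‖ * (1 / (2 * c)) ^ i ≤ c * c ^ i * (1 / (2 * c)) ^ i := by
          gcongr
          exact mem_boundedSeries.1 hp i
      _ = c * (1 / 2) ^ i := by
          rw [mul_assoc, ← mul_pow]
          congr 2
          field_simp
      _ ≤ c * 1 := by
          gcongr
          exact pow_le_one₀ (by norm_num) (by norm_num)
      _ = c := mul_one c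
  have h := ((q.hasFPowerSeriesOnBall (hr0.trans_le hr)).mono hr0 hr).comp_sub z₀
  rw [zero_add] at h
  have h2 := h.analyticOnNhd
  have h3 : Metric.eball z₀ (r : ENNReal) = Metric.ball z₀ (1 / (2 * c)) := Metric.eball_coe
  rwa [h3] at h2

theorem AnalyticAt.exists_boundedSeries {f : E → ℂ} {z₀ : E} (hf : AnalyticAt ℂ f z₀) :
    ∃ m : ℕ, ∃ p ∈ boundedSeries E (m + 1), ∀ᶠ z in 𝓝 z₀, f z = seriesSum p (z - z₀) := by
  obtain ⟨q, hq⟩ := hf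
  obtain ⟨C, r, hC, hr, hb⟩ := q.le_mul_pow_of_radius_pos hq.radius_pos
  obtain ⟨m, hm⟩ := exists_nat_ge (max C r)
  refine ⟨m, q, mem_boundedSeries.2 fun i => (hb i).trans ?_, ?_⟩
  · have h1 := (le_max_left C r).trans hm
    have h2 := (le_max_right C r).trans hm
    gcongr <;> linarith
  · filter_upwards [hq.eventually_hasSum_sub] with z hz
    exact hz.tsum_eq.symm

end PowerSeries

/-- Baire's theorem on a product of compact spaces: a basic open set restricts finitely many
coordinates only. -/
theorem exists_forall_update_mem_of_iUnion {Z : Type*} [TopologicalSpace Z] [CompactSpace Z]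
    [T2Space Z] [Nonempty Z] {A : ℕ → Set (ℕ → Z)} (hA : ∀ m, IsClosed (A m))
    (hU : ⋃ m, A m = univ) :
    ∃ (m : ℕ) (t : ℕ → Z) (I : Finset ℕ), ∀ j ∉ I, ∀ s, Function.update t j s ∈ A m := by
  obtain ⟨m, t, ht⟩ := nonempty_interior_of_iUnion_of_closed hA hU
  obtain ⟨I, w, hw, hwA⟩ := isOpen_pi_iff.1 isOpen_interior t ht
  refine ⟨m, t, I, fun j hj s => interior_subset (hwA fun i hi => ?_)⟩
  have : i ≠ j := by
    rintro rfl
    exact hj hi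
  simpa [Function.update_of_ne this] using (hw i hi).2

theorem tsum_update_sub_tsum_update {t : ℕ → unitInterval} {z : ℕ → ℂ} (hz : Summable (‖z ·‖))
    (j : ℕ) :
    (∑' m, ((Function.update t j 1 m : ℝ) : ℂ) * z m)
      - ∑' m, ((Function.update t j 0 m : ℝ) : ℂ) * z m = z j := by
  have hs : ∀ t : ℕ → unitInterval, Summable fun m => ((t m : ℝ) : ℂ) * z m := fun t =>
    Summable.of_norm_bounded hz fun m => norm_ofReal_mul_le (t m).2 _
  rw [← (hs _).tsum_sub (hs _), tsum_eq_single j]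
  · simp
  · intro m hm
    simp [Function.update_of_ne hm]

section Extension

variable {n k N : ℕ} {M X : Type*} [TopologicalSpace M]
  [ChartedSpace (RModel (2 * n + k)) M] [IsManifold (𝓡 (2 * n + k)) ∞ M]
  [TopologicalSpace X] [ChartedSpace (CModel N) X] [IsManifold 𝓘(ℂ, CModel N) ω X]
  {S : CRStructure n k M} {φ : M → X}

variable (N) in
/-- The germ of `u` at `a` is the restriction of a function that is holomorphic on the ball of radius
`r` about `φ a` in the preferred chart there. The function lives on the model space, and the ball
need not lie in the target of the chart. -/
def ExtendsToBall (φ : M → X) (a : M) (r : ℝ) (u : M → ℂ) : Prop :=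
  ∃ f : CModel N → ℂ,
    AnalyticOnNhd ℂ f (Metric.ball (extChartAt 𝓘(ℂ, CModel N) (φ a) (φ a)) r) ∧
    ∀ᶠ x in 𝓝 a, f (extChartAt 𝓘(ℂ, CModel N) (φ a) (φ x)) = u x

/-- Unique continuation in the form in which it is used: a CR function on a connected open set that is
near one point the restriction of a holomorphic function, given in a chart of `X`, is so
throughout. -/
theorem IsEPair.eqOn_of_analyticOnNhd (hE : IsEPair N S φ) {u : M → ℂ} {U : Set M}
    (hU : IsOpen U) (hUc : IsPreconnected U) (hu : IsCROn S u U) {a : M} (ha : a ∈ U) (p : X)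
    {f : CModel N → ℂ} {s : Set (CModel N)} (hs : IsOpen s) (hf : AnalyticOnNhd ℂ f s)
    (hUs : ∀ x ∈ U, φ x ∈ (extChartAt 𝓘(ℂ, CModel N) p).source ∩
      extChartAt 𝓘(ℂ, CModel N) p ⁻¹' s)
    (h : ∀ᶠ x in 𝓝 a, u x = f (extChartAt 𝓘(ℂ, CModel N) p (φ x))) :
    ∀ x ∈ U, u x = f (extChartAt 𝓘(ℂ, CModel N) p (φ x)) := by
  have hB : IsOpen ((extChartAt 𝓘(ℂ, CModel N) p).source ∩ extChartAt 𝓘(ℂ, CModel N) p ⁻¹' s) :=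
    (continuousOn_extChartAt p).isOpen_inter_preimage (isOpen_extChartAt_source p) hs
  have hv := (hE.toIsCRMap.isCROn_comp (S := S) hB (isHolomorphicOn_comp_extChartAt hf p)).mono hUs
  have hd := hu.add hU ((isCROn_const (S := S) (-1) U).mul hU hv)
  intro x hx
  have := hE.eqOn_zero_of_isPreconnected hU hUc hd ha
    (h.mono fun y hy => by simp [hy]) hx
  have h' : u x + -1 * f (extChartAt 𝓘(ℂ, CModel N) p (φ x)) = 0 := this
  linear_combination h'

/-- A single radius serves all CR functions on `W`. -/
theorem IsEPair.exists_uniform_radius (hE : IsEPair N S φ) {W : Set M} (hW : IsOpen W) {a : M}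
    (ha : a ∈ W) : ∃ r > 0, ∀ u, IsCROn S u W → ExtendsToBall N φ a r u := by
  set e := extChartAt (𝓡 (2 * n + k)) a with he
  set ψ := extChartAt 𝓘(ℂ, CModel N) (φ a) with hψ
  have hcont : Continuous φ := hE.toIsCRMap.smooth.continuous
  by_contra! hcon
  let r : ℕ → ℝ := fun m => 1 / (2 * ((m : ℝ) + 1))
  have hr : ∀ m, 0 < r m := fun m => by positivity
  choose u hu hnot using fun m => hcon (r m) (hr m)
  -- `v m` is the scaled cut-off of `u m` in the chart, and `T t` the sum of the series with weights `t`.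
  obtain ⟨U, hUo, haU, hUW, hUe, hUg⟩ :=
    exists_contDiff_eqOn_extChartAt (d := 2 * n + k) a (hW.mem_nhds ha)
  choose g hg hgc hgu using fun m => hUg (u m) (hu m).smooth
  obtain ⟨ε, hε, hb⟩ := exists_pos_forall_norm_iteratedFDeriv_smul_le g hg hgc
  let v : ℕ → RModel (2 * n + k) → ℂ := fun m y => (ε m : ℂ) * g m y
  have hv : ∀ m, ContDiff ℝ ∞ (v m) := fun m => contDiff_const.mul (hg m)
  have hvu : ∀ m, ∀ x ∈ U, v m (e x) = ε m * u m x := fun m x hx => by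
    simp only [v]
    rw [hgu m x hx]
  have hcr : ∀ m, IsCROn S (v m ∘ e) U := fun m =>
    ((isCROn_const (S := S) (ε m : ℂ) U).mul hUo ((hu m).mono hUW)).congr hUo (hvu m)
  let T : (ℕ → unitInterval) → M → ℂ := fun t x => ∑' m, ((t m : ℝ) : ℂ) * v m (e x)
  have hT : ∀ t, IsCROn S (T t) U := fun t => isCROn_tsum hUo hUe hv hb hcr fun m => (t m).2
  have : LocallyConnectedSpace M := ChartedSpace.locallyConnectedSpace (RModel (2 * n + k)) M
  -- The neighbourhood `Um m` must not depend on `t`: this makes `A m` closed.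
  have hUm : ∀ m, ∃ V ⊆ U ∩ φ ⁻¹' (ψ.source ∩ ψ ⁻¹' Metric.ball (ψ (φ a)) (r m)),
      IsOpen V ∧ a ∈ V ∧ IsConnected V := fun m => by
    refine locallyConnectedSpace_iff_subsets_isOpen_isConnected.1 this a _ ?_
    refine inter_mem (hUo.mem_nhds haU) (hcont.continuousAt.preimage_mem_nhds ?_)
    exact inter_mem (extChartAt_source_mem_nhds _)
      ((continuousAt_extChartAt _).preimage_mem_nhds (Metric.ball_mem_nhds _ (hr m)))
  choose Um hUmsub hUmo haUm hUmc using hUm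
  let A : ℕ → Set (ℕ → unitInterval) := fun m =>
    {t | ∃ p : boundedSeries (CModel N) (m + 1), ∀ x ∈ Um m,
      T t x = seriesSum (p : ∀ i : ℕ, CModel N [×i]→L[ℂ] ℂ) (ψ (φ x) - ψ (φ a))}
  have hAclosed : ∀ m, IsClosed (A m) := by
    intro m
    have : CompactSpace (boundedSeries (CModel N) (m + 1)) :=
      isCompact_iff_compactSpace.1 (isCompact_boundedSeries _)
    have hAeq : A m = Prod.fst '' {q : (ℕ → unitInterval) × boundedSeries (CModel N) (m + 1) |
        ∀ x ∈ Um m, T q.1 x =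
          seriesSum (q.2 : ∀ i : ℕ, CModel N [×i]→L[ℂ] ℂ) (ψ (φ x) - ψ (φ a))} := by
      ext t
      simp [A]
    rw [hAeq]
    refine isClosedMap_fst_of_compactSpace _ ?_
    simp only [ofPred_forall]
    refine isClosed_biInter fun x hx => isClosed_eq ?_ ?_
    · exact (continuous_tsum_ofReal_mul hb (e x)).comp continuous_fst
    · refine (continuous_seriesSum (by positivity) ?_).comp continuous_snd
      have := (hUmsub m hx).2.2
      rwa [mem_preimage, mem_ball_iff_norm] at this
  have hAcover : ⋃ m, A m = univ := by
    refine iUnion_eq_univ_iff.2 fun t => ?_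
    obtain ⟨F, V, hV, haV, hF, hFT⟩ := hE.exists_extension hUo haU (hT t)
    have hFa : AnalyticAt ℂ (F ∘ ψ.symm) (ψ (φ a)) :=
      hF.analyticOnNhd_comp_symm hV (φ a) _ ⟨mem_extChartAt_target _, by
        rwa [mem_preimage, extChartAt_to_inv]⟩
    obtain ⟨m, p, hp, hpF⟩ := hFa.exists_boundedSeries
    refine ⟨m, ⟨p, hp⟩, hE.eqOn_of_analyticOnNhd (hUmo m) (hUmc m).isPreconnected
      ((hT t).mono fun x hx => (hUmsub m hx).1) (haUm m) (φ a) Metric.isOpen_ball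
      (analyticOnNhd_seriesSum_sub (by positivity) hp (ψ (φ a)))
      (fun x hx => (hUmsub m hx).2) ?_⟩
    have h1 : ∀ᶠ x in 𝓝 a, ψ (φ x) ∈ {z | (F ∘ ψ.symm) z = seriesSum p (z - ψ (φ a))} :=
      (ContinuousAt.comp (f := φ) (continuousAt_extChartAt (φ a))
        hcont.continuousAt).eventually hpF
    filter_upwards [h1, hFT, (hUmo m).mem_nhds (haUm m)] with x hx1 hx2 hx3
    rw [← hx2]
    have h2 : F (ψ.symm (ψ (φ x))) = _ := hx1
    rwa [ψ.left_inv (hUmsub m hx3).2.1] at h2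
  obtain ⟨m, t, I, hI⟩ := exists_forall_update_mem_of_iUnion hAclosed hAcover
  -- A free coordinate `j ≥ m`: the sums with `t j = 1` and `t j = 0` differ by `ε j * u j`.
  obtain ⟨j, hj⟩ := Infinite.exists_notMem_finset (I ∪ Finset.range m)
  rw [Finset.mem_union, not_or, Finset.mem_range, not_lt] at hj
  obtain ⟨⟨p₁, hp₁⟩, h₁⟩ := hI j hj.1 1
  obtain ⟨⟨p₀, hp₀⟩, h₀⟩ := hI j hj.1 0
  refine hnot j ⟨fun z => (ε j : ℂ)⁻¹ *
    (seriesSum p₁ (z - ψ (φ a)) - seriesSum p₀ (z - ψ (φ a))), ?_, ?_⟩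
  · have hle : r j ≤ r m := by
      have : (m : ℝ) ≤ j := by exact_mod_cast hj.2
      simp only [r]
      gcongr
    exact (analyticOnNhd_const.mul ((analyticOnNhd_seriesSum_sub (by positivity) hp₁ _).sub
      (analyticOnNhd_seriesSum_sub (by positivity) hp₀ _))).mono (Metric.ball_subset_ball hle)
  · filter_upwards [(hUmo m).mem_nhds (haUm m)] with x hx
    have hsum : Summable fun i => ‖v i (e x)‖ :=
      Summable.of_nonneg_of_le (fun _ => norm_nonneg _)
        (fun i => norm_iteratedFDeriv_zero (𝕜 := ℝ) (f := v i) (x := e x) ▸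
          hb i 0 (by omega) (e x))
        summable_geometric_two
    have h := tsum_update_sub_tsum_update (t := t) hsum j
    rw [hvu j x (hUmsub m hx).1] at h
    have h₁' := h₁ x hx
    have h₀' := h₀ x hx
    simp only [T] at h₁' h₀'
    rw [← h₁', ← h₀', h, inv_mul_cancel_left₀ (by exact_mod_cast (hε j).ne')]

end Extension

/-! ### Gluing the local extensions -/

section Gluing

variable {n k N : ℕ} {M X : Type*} [TopologicalSpace M]
  [ChartedSpace (RModel (2 * n + k)) M] [IsManifold (𝓡 (2 * n + k)) ∞ M]
  [TopologicalSpace X] [ChartedSpace (CModel N) X] [IsManifold 𝓘(ℂ, CModel N) ω X]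
  {S : CRStructure n k M} {φ : M → X}

/-- A single neighbourhood of `φ a` serves all CR functions on `W`: as `φ` is an embedding, it
can be taken to meet `M` only inside a connected `U ⊆ W`, where `F ∘ φ = u` holds throughout. -/
theorem IsEPair.exists_common_extension (hE : IsEPair N S φ) {W : Set M} (hW : IsOpen W)
    {a : M} (ha : a ∈ W) :
    ∃ O : Set X, IsOpen O ∧ φ a ∈ O ∧ φ ⁻¹' O ⊆ W ∧ ∀ u, IsCROn S u W →
      ∃ F : X → ℂ, IsHolomorphicOn N F O ∧ ∀ x, φ x ∈ O → F (φ x) = u x := by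
  have hcont : Continuous φ := hE.toIsCRMap.smooth.continuous
  obtain ⟨r, hr, hext⟩ := hE.exists_uniform_radius hW ha
  set ψ := extChartAt 𝓘(ℂ, CModel N) (φ a) with hψ
  have hBo : IsOpen (ψ.source ∩ ψ ⁻¹' Metric.ball (ψ (φ a)) r) :=
    (continuousOn_extChartAt _).isOpen_inter_preimage (isOpen_extChartAt_source _)
      Metric.isOpen_ball
  have haB : φ a ∈ ψ.source ∩ ψ ⁻¹' Metric.ball (ψ (φ a)) r :=
    ⟨mem_extChartAt_source _, Metric.mem_ball_self hr⟩
  have : LocallyConnectedSpace M := ChartedSpace.locallyConnectedSpace (RModel (2 * n + k)) M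
  obtain ⟨U, hUsub, hUo, haU, hUc⟩ := locallyConnectedSpace_iff_subsets_isOpen_isConnected.1 this a
    (W ∩ φ ⁻¹' (ψ.source ∩ ψ ⁻¹' Metric.ball (ψ (φ a)) r))
    (inter_mem (hW.mem_nhds ha) (hcont.continuousAt.preimage_mem_nhds (hBo.mem_nhds haB)))
  obtain ⟨O, hOo, hOU⟩ := hE.embedding.isEmbedding.isOpen_iff.1 hUo
  refine ⟨O ∩ (ψ.source ∩ ψ ⁻¹' Metric.ball (ψ (φ a)) r), hOo.inter hBo, ⟨?_, haB⟩, ?_, ?_⟩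
  · exact hOU.ge haU
  · exact fun x hx => (hUsub (hOU.le hx.1)).1
  · intro u hu
    obtain ⟨f, hf, hfu⟩ := hext u hu
    refine ⟨f ∘ ψ, (isHolomorphicOn_comp_extChartAt hf (φ a)).mono inter_subset_right,
      fun x hx => ?_⟩
    exact (hE.eqOn_of_analyticOnNhd hUo hUc.isPreconnected (hu.mono fun x hx => (hUsub hx).1) haU
      (φ a) Metric.isOpen_ball hf (fun x hx => (hUsub hx).2) (hfu.mono fun x hx => hx.symm) x
      (hOU.le hx.1)).symm

end Gluing

theorem theorem1p1 {n k N : ℕ} {M X : Type*}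
    [TopologicalSpace M] [T2Space M] [ParacompactSpace M] [ConnectedSpace M]
    [ChartedSpace (RModel (2 * n + k)) M] [IsManifold (𝓡 (2 * n + k)) ∞ M]
    (S : CRStructure n k M)
    [TopologicalSpace X] [T2Space X] [ParacompactSpace X]
    [ChartedSpace (CModel N) X] [IsManifold 𝓘(ℂ, CModel N) ω X]
    (φ : M → X) (hE : IsEPair N S φ) (W : TopologicalSpace.Opens M) :
    ∃ (Ω : TopologicalSpace.Opens X) (hΩ : φ ⁻¹' (Ω : Set X) = (W : Set M)),
      Function.Bijective (hE.toIsCRMap.restrict Ω W (fun _ hx => hΩ.ge hx)) := by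
  have : LocallyCompactSpace M := ChartedSpace.locallyCompactSpace (RModel (2 * n + k)) M
  have : SigmaCompactSpace M := sigmaCompactSpace_of_connected_paracompact M
  have hcont : Continuous φ := hE.toIsCRMap.smooth.continuous
  choose O hOo haO hOW hOext using fun a : W => hE.exists_common_extension W.isOpen a.2
  obtain ⟨V₀, hV₀o, haV₀, hV₀⟩ := exists_open_nhds_subset_or_subset (H := CModel N) hcont
    (fun a : W => (a : M)) O fun a => (hOo a).mem_nhds (haO a)
  choose V hVo haV hVsub hVid using fun a : W =>
    exists_nhd_identity (N := N) (φ a) ((hV₀o a).mem_nhds (haV₀ a))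
  have hVO : ∀ a, V a ⊆ O a := fun a =>
    (hVsub a).trans ((hV₀ a a ⟨φ a, haV₀ a, haV₀ a⟩).elim id id)
  let Ω : TopologicalSpace.Opens X := ⟨⋃ a, V a, isOpen_iUnion hVo⟩
  have hΩ : φ ⁻¹' (Ω : Set X) = (W : Set M) := by
    ext x
    constructor
    · intro hx
      obtain ⟨a, ha⟩ := mem_iUnion.1 hx
      exact hOW a (hVO a ha)
    · exact fun hx => mem_iUnion.2 ⟨⟨x, hx⟩, haV ⟨x, hx⟩⟩
  refine ⟨Ω, hΩ, ?_, ?_⟩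
  · rintro ⟨f, F, hF, hf⟩ ⟨g, G, hG, hg⟩ hfg
    have hFG : ∀ x ∈ W, F (φ x) = G (φ x) := by
      intro x hx
      have h1 := congrFun (congrArg Subtype.val hfg) ⟨x, hx⟩
      exact (hf _).symm.trans (h1.trans (hg _))
    refine Subtype.ext (funext fun z => ?_)
    change f z = g z
    rw [hf, hg]
    obtain ⟨a, ha⟩ := mem_iUnion.1 z.2
    have hVΩ : V a ⊆ Ω := subset_iUnion V a
    exact hE.eqOn_of_comp_eventuallyEq (hVo a) (hVid a) (hF.mono hVΩ) (hG.mono hVΩ) (haV a)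
      (eventually_of_mem (W.isOpen.mem_nhds a.2) hFG) ha
  · rintro ⟨w, u, hu, hw⟩
    choose F hF hFu using fun a => hOext a u hu
    have hagree : ∀ a b : W, V₀ b ⊆ O a → EqOn (F a) (F b) (V b) := by
      intro a b hab
      refine hE.eqOn_of_comp_eventuallyEq (hVo b) (hVid b) ((hF a).mono ((hVsub b).trans hab))
        ((hF b).mono (hVO b)) (haV b) ?_
      filter_upwards [((hVo b).preimage hcont).mem_nhds (haV b)] with x hx
      exact (hFu a x (hab (hVsub b hx))).trans (hFu b x (hVO b hx)).symm
    have hcompat : ∀ a b : W, ∀ z ∈ V a, z ∈ V b → F a z = F b z := by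
      intro a b z hza hzb
      rcases hV₀ a b ⟨z, hVsub a hza, hVsub b hzb⟩ with h | h
      · exact hagree a b h hzb
      · exact (hagree b a h hza).symm
    classical
    let G : X → ℂ := fun z => if h : ∃ a, z ∈ V a then F h.choose z else 0
    have hGF : ∀ a, EqOn G (F a) (V a) := by
      intro a z hz
      have h : ∃ a, z ∈ V a := ⟨a, hz⟩
      simp only [G, dif_pos h]
      exact hcompat _ _ z h.choose_spec hz
    have hG : IsHolomorphicOn N G Ω := by
      intro z hz
      obtain ⟨a, ha⟩ := mem_iUnion.1 hz
      have h1 : ContMDiffAt 𝓘(ℂ, CModel N) 𝓘(ℂ, ℂ) ω (F a) z :=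
        ContMDiffOn.contMDiffAt ((hF a).mono (hVO a)) ((hVo a).mem_nhds ha)
      exact (h1.congr_of_eventuallyEq
        ((hGF a).eventuallyEq_of_mem ((hVo a).mem_nhds ha))).contMDiffWithinAt
    refine ⟨⟨fun z => G z, G, hG, fun _ => rfl⟩, Subtype.ext (funext fun x => ?_)⟩
    change G (φ x) = w x
    rw [hw, hGF x (haV x), hFu x _ (haO x)]
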